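/- Let $K$ be a field with $\mathrm{char}\,K\neq 2$ and let $V$ be a $K$-vector space (of arbitrary dimension). For a $K$-linear map $\alpha:V\otimes V\to W$ write $\alpha_1=\alpha\otimes \mathrm{Id}_V$ and $\alpha_2=\mathrm{Id}_V\otimes\alpha$, both defined on $V\otimes V\otimes V$. Let $c:V\otimes V\to V\otimes V$ be a $K$-linear map that satisfies the braid equation $c_1c_2c_1=c_2c_1c_2$ (so $(V,c)$ is a braided vector space), and suppose that $c$ is of Hecke type of mark $\lambda\in K$, i.e. $(c+\mathrm{Id})(c-\lambda\,\mathrm{Id})=0$, where $\lambda\neq 0$ and $(3)!_\lambda=(1+\lambda)(1+\lambda+\lambda^2)\neq 0$. Let $b:V\otimes V\to V$ be a $c$-bracket, i.e. a $K$-linear map with $cb_1=b_2c_1c_2$ and $cb_2=b_1c_2c_1$. Let $U(V,c,b)=T(V)/I$ be its enveloping algebra, where $T(V)$ is the tensor algebra and $I$ is the two-sided ideal generated by all $c(z)-\lambda z-b(z)$, $z\in V\otimes V=T^2(V)$. Assume that the canonical $K$-linear map $V\to U(V,c,b)$ is injective. Then: 1. if $\lambda\neq 1$, then $b=0$; 2.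 if $\lambda=1$, then $$bc=-b\qquad\text{and}\qquad bb_1(\mathrm{Id}_{V^{\otimes 3}}-c_2+c_2c_1)=0,$$ i.e. $(V,c,b)$ is a generalized Lie algebra, meaning that $c$ is a braiding with $c^2=\mathrm{Id}$ and $b$ is a $c$-bracket satisfying these two identities. -/

import Mathlib

open scoped TensorProduct

namespace BraidedLie

noncomputable section

section Braidings

variable {K : Type*} [Field K] {V : Type*} [AddCommGroup V] [Module K V]

/-- For `α : V ⊗ V → W`, the map `α₁ = α ⊗ V : V ⊗ V ⊗ V → W ⊗ V`. -/
def map₁ {W : Type*} [AddCommGroup W] [Module K W] (α : V ⊗[K] V →ₗ[K] W) :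
    (V ⊗[K] V) ⊗[K] V →ₗ[K] W ⊗[K] V :=
  LinearMap.rTensor V α

/-- For `α : V ⊗ V → W`, the map `α₂ = V ⊗ α : V ⊗ V ⊗ V → V ⊗ W`. -/
def map₂ {W : Type*} [AddCommGroup W] [Module K W] (α : V ⊗[K] V →ₗ[K] W) :
    (V ⊗[K] V) ⊗[K] V →ₗ[K] V ⊗[K] W :=
  LinearMap.lTensor V α ∘ₗ (TensorProduct.assoc K V V V).toLinearMap

/-- The operator `c₁ = c ⊗ V` on `V ⊗ V ⊗ V`. -/
def op₁ (c : V ⊗[K] V →ₗ[K] V ⊗[K] V) :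
    (V ⊗[K] V) ⊗[K] V →ₗ[K] (V ⊗[K] V) ⊗[K] V :=
  map₁ c

/-- The operator `c₂ = V ⊗ c` on `V ⊗ V ⊗ V`, where `V ⊗ (V ⊗ V)` and `(V ⊗ V) ⊗ V` are
identified by the associativity isomorphism. -/
def op₂ (c : V ⊗[K] V →ₗ[K] V ⊗[K] V) :
    (V ⊗[K] V) ⊗[K] V →ₗ[K] (V ⊗[K] V) ⊗[K] V :=
  (TensorProduct.assoc K V V V).symm.toLinearMap ∘ₗ map₂ c

/-- `(V, c)` is a braided vector space: `c₁ c₂ c₁ = c₂ c₁ c₂`. -/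
def IsBraiding (c : V ⊗[K] V →ₗ[K] V ⊗[K] V) : Prop :=
  op₁ c ∘ₗ op₂ c ∘ₗ op₁ c = op₂ c ∘ₗ op₁ c ∘ₗ op₂ c

/-- `c` is of Hecke type of mark `lam`: `(c + Id)(c - lam Id) = 0`. -/
def IsHecke (c : V ⊗[K] V →ₗ[K] V ⊗[K] V) (lam : K) : Prop :=
  (c + LinearMap.id) ∘ₗ (c - lam • LinearMap.id) = 0

/-- `b` is a `c`-bracket: `c b₁ = b₂ c₁ c₂` and `c b₂ = b₁ c₂ c₁`. -/
structure IsBracket (c : V ⊗[K] V →ₗ[K] V ⊗[K] V) (b : V ⊗[K] V →ₗ[K] V) : Prop where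
  comp_map₁ : c ∘ₗ map₁ b = map₂ b ∘ₗ op₁ c ∘ₗ op₂ c
  comp_map₂ : c ∘ₗ map₂ b = map₁ b ∘ₗ op₂ c ∘ₗ op₁ c

/-- `(V, c, b)` is a generalized Lie algebra: `c` is an involutive braiding and `b` is a
`c`-bracket that is braided antisymmetric and satisfies the braided Jacobi identity. -/
structure IsGeneralizedLieAlgebra (c : V ⊗[K] V →ₗ[K] V ⊗[K] V) (b : V ⊗[K] V →ₗ[K] V) :
    Prop where
  braiding : IsBraiding c
  involutive : c ∘ₗ c = LinearMap.id
  bracket : IsBracket c b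
  antisymm : b ∘ₗ c = -b
  jacobi : b ∘ₗ map₁ b ∘ₗ (LinearMap.id - op₂ c + op₂ c ∘ₗ op₁ c) = 0

/-- The canonical map `V ⊗ V → T(V)`, `v ⊗ w ↦ v w`, with image `T²(V)`. -/
def tensorSq : V ⊗[K] V →ₗ[K] TensorAlgebra K V :=
  LinearMap.mul' K (TensorAlgebra K V) ∘ₗ
    TensorProduct.map (TensorAlgebra.ι K) (TensorAlgebra.ι K)

/-- The set `{c(z) - lam z - b(z) | z ∈ V ⊗ V}` in the tensor algebra `T(V)`. -/
def relSet (c : V ⊗[K] V →ₗ[K] V ⊗[K] V) (lam : K) (b : V ⊗[K] V →ₗ[K] V) :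
    Set (TensorAlgebra K V) :=
  {t | ∃ z : V ⊗[K] V, t = tensorSq (c z) - lam • tensorSq z - TensorAlgebra.ι K (b z)}

/-- The two-sided ideal of `T(V)` generated by `relSet c lam b`. -/
def envelopingIdeal (c : V ⊗[K] V →ₗ[K] V ⊗[K] V) (lam : K) (b : V ⊗[K] V →ₗ[K] V) :
    TwoSidedIdeal (TensorAlgebra K V) :=
  TwoSidedIdeal.span (relSet c lam b)

/-- The enveloping algebra `U(V, c, b)`, for `c` of Hecke type of mark `lam`. -/
abbrev EnvelopingAlgebra (c : V ⊗[K] V →ₗ[K] V ⊗[K] V) (lam : K) (b : V ⊗[K] V →ₗ[K] V) :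
    Type _ :=
  (envelopingIdeal c lam b).ringCon.Quotient

/-- The canonical projection `T(V) → U(V, c, b)`. -/
def envelopingProj (c : V ⊗[K] V →ₗ[K] V ⊗[K] V) (lam : K) (b : V ⊗[K] V →ₗ[K] V) :
    TensorAlgebra K V →ₐ[K] EnvelopingAlgebra c lam b :=
  (envelopingIdeal c lam b).ringCon.mkₐ K

/-- The canonical linear map `V → U(V, c, b)`. -/
def envelopingι (c : V ⊗[K] V →ₗ[K] V ⊗[K] V) (lam : K) (b : V ⊗[K] V →ₗ[K] V) :
    V →ₗ[K] EnvelopingAlgebra c lam b :=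
  (envelopingProj c lam b).toLinearMap ∘ₗ TensorAlgebra.ι K

end Braidings

/-- `(0)_x = 1` and `(n)_x = 1 + x + ⋯ + x ^ (n - 1)` for `n > 0`. -/
def qNumber {K : Type*} [Field K] (x : K) : ℕ → K
  | 0 => 1
  | n + 1 => ∑ i ∈ Finset.range (n + 1), x ^ i

/-- `(0)!_x = 1` and `(n)!_x = (1)_x (2)_x ⋯ (n)_x`. -/
def qFactorial {K : Type*} [Field K] (x : K) : ℕ → K
  | 0 => 1
  | n + 1 => qFactorial x n * qNumber x (n + 1)

end

end BraidedLie

/-!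
Injectivity of `V → U(V, c, b)` is used only for two explicit elements of `V` that the defining
relations send to `0` in `U`: one comes from `V ⊗ V`, and gives antisymmetry, the other from
`V ⊗ V ⊗ V`, and gives the Jacobi identity. The rest is computation in `V ⊗ V`.

* Degree two. The relation for `z = c w + w` has leading term `(c - λ)(c + 1) w = 0`, so
  `b (c w + w)` vanishes in `U`, hence in `V`. Thus `b c = -b` (`bracket_comp_of_injective`), for
  every mark `λ`.

* The case `λ ≠ 1`. Put `Cᵢ = c bᵢ`. Expanding `b₁ c₂ c₁ c₁ c₂` in two ways, with the bracket axioms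
  and with the Hecke relation, and cancelling `λ - 1`, gives `λ b₁ c₂ = C₁ - λ b₁ + C₂`
  (`smul_bracket_braid`); the same holds with `1` and `2` exchanged. Composing with `c₁` yields
  `(1 + λ²) C₂ + C₁ = λ (1 + λ) b₁ + λ b₂`, and adding the mirror image shows that
  `s = b₁ + b₂` satisfies `(2 + λ²) c s = λ (2 + λ) s`. As `(c + 1)(c - λ) = 0`, the vector `s` is
  killed by `2 (1 + λ + λ²) λ² (1 - λ) ≠ 0`, so `b₁ = -b₂` (`map₁_add_map₂_eq_zero`).
  That identity, `b(x, y) ⊗ z = -x ⊗ b(y, z)`, forces `b = 0` away from characteristic two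
  (`eq_zero_of_map₁_add_map₂`).

* The case `λ = 1`. The antisymmetrizer of three letters is divisible on the left by `c₁ - 1` and
  by `c₂ - 1`; the two quotients give an element `w` of `V ⊗ V` that vanishes in `U`. The bracket
  axioms give `c w = -w`, so the defining relation for `w` reads `0 = b w` in `U`, and
  `b w = 2 b b₁ (1 - c₂ + c₂ c₁)` (`jacobi_of_injective`).
-/

namespace BraidedLie

open TensorProduct

section Pointwise

variable {K : Type*} [Field K] {V : Type*} [AddCommGroup V] [Module K V]
  {c : V ⊗[K] V →ₗ[K] V ⊗[K] V} {lam : K} {b : V ⊗[K] V →ₗ[K] V}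

theorem IsHecke.apply_apply (h : IsHecke c lam) (z : V ⊗[K] V) :
    c (c z) = (lam - 1) • c z + lam • z := by
  have := LinearMap.congr_fun h z
  simp only [LinearMap.comp_apply, LinearMap.add_apply, LinearMap.sub_apply, LinearMap.smul_apply,
    LinearMap.id_apply, LinearMap.zero_apply, map_sub, map_smul] at this
  linear_combination (norm := module) this

theorem map₁_op₁ {W : Type*} [AddCommGroup W] [Module K W] (a : V ⊗[K] V →ₗ[K] W)
    (c : V ⊗[K] V →ₗ[K] V ⊗[K] V) (t : (V ⊗[K] V) ⊗[K] V) :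
    map₁ a (op₁ c t) = map₁ (a ∘ₗ c) t := by
  simp [map₁, op₁, LinearMap.rTensor_comp]

theorem map₂_op₂ {W : Type*} [AddCommGroup W] [Module K W] (a : V ⊗[K] V →ₗ[K] W)
    (c : V ⊗[K] V →ₗ[K] V ⊗[K] V) (t : (V ⊗[K] V) ⊗[K] V) :
    map₂ a (op₂ c t) = map₂ (a ∘ₗ c) t := by
  simp [map₂, op₂, LinearMap.lTensor_comp]

theorem IsHecke.op₁_op₁ (h : IsHecke c lam) (t : (V ⊗[K] V) ⊗[K] V) :
    op₁ c (op₁ c t) = (lam - 1) • op₁ c t + lam • t := by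
  have hcc : c ∘ₗ c = (lam - 1) • c + lam • LinearMap.id := by
    ext1; ext1; ext1; simpa using h.apply_apply _
  have := map₁_op₁ c c t
  rw [hcc] at this
  simpa [map₁, op₁, LinearMap.rTensor_add, LinearMap.rTensor_smul] using this

theorem IsHecke.op₂_op₂ (h : IsHecke c lam) (t : (V ⊗[K] V) ⊗[K] V) :
    op₂ c (op₂ c t) = (lam - 1) • op₂ c t + lam • t := by
  have hcc : c ∘ₗ c = (lam - 1) • c + lam • LinearMap.id := by
    ext1; ext1; ext1; simpa using h.apply_apply _
  have := congrArg (TensorProduct.assoc K V V V).symm (map₂_op₂ c c t)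
  rw [hcc] at this
  simpa [map₂, op₂, LinearMap.lTensor_add, LinearMap.lTensor_smul] using this

theorem map₁_op₁_of_antisymm (h : b ∘ₗ c = -b) (t : (V ⊗[K] V) ⊗[K] V) :
    map₁ b (op₁ c t) = -map₁ b t := by
  rw [map₁_op₁, h]; simp [map₁, LinearMap.rTensor_neg]

theorem map₂_op₂_of_antisymm (h : b ∘ₗ c = -b) (t : (V ⊗[K] V) ⊗[K] V) :
    map₂ b (op₂ c t) = -map₂ b t := by
  rw [map₂_op₂, h]; simp [map₂, LinearMap.lTensor_neg]

theorem IsBraiding.apply (h : IsBraiding c) (t : (V ⊗[K] V) ⊗[K] V) :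
    op₁ c (op₂ c (op₁ c t)) = op₂ c (op₁ c (op₂ c t)) :=
  LinearMap.congr_fun h t

theorem IsBracket.apply_map₁ (h : IsBracket c b) (t : (V ⊗[K] V) ⊗[K] V) :
    c (map₁ b t) = map₂ b (op₁ c (op₂ c t)) :=
  LinearMap.congr_fun h.comp_map₁ t

theorem IsBracket.apply_map₂ (h : IsBracket c b) (t : (V ⊗[K] V) ⊗[K] V) :
    c (map₂ b t) = map₁ b (op₂ c (op₁ c t)) :=
  LinearMap.congr_fun h.comp_map₂ t

end Pointwise

/-! ### Antisymmetric brackets for a Hecke operator of mark different from one -/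

section HeckeModule

variable {K : Type*} [Field K] {T W : Type*} [AddCommGroup T] [Module K T]
  [AddCommGroup W] [Module K W]

/-- `A`, `B`, `C` stand for `c₁`, `c₂`, `c`, and `f`, `g` for `b₁`, `b₂`. The hypotheses are
invariant under exchanging `(A, f)` with `(B, g)`, so each lemma on this structure comes with its
mirror image. -/
structure HeckePair (lam : K) (A B : T →ₗ[K] T) (C : W →ₗ[K] W) (f g : T →ₗ[K] W) : Prop where
  sqA : ∀ t, A (A t) = (lam - 1) • A t + lam • t
  sqB : ∀ t, B (B t) = (lam - 1) • B t + lam • t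
  sqC : ∀ w, C (C w) = (lam - 1) • C w + lam • w
  braid : ∀ t, A (B (A t)) = B (A (B t))
  antif : ∀ t, f (A t) = -f t
  antig : ∀ t, g (B t) = -g t
  compf : ∀ t, C (f t) = g (A (B t))
  compg : ∀ t, C (g t) = f (B (A t))

variable {lam : K} {A B : T →ₗ[K] T} {C : W →ₗ[K] W} {f g : T →ₗ[K] W}

theorem HeckePair.symm (h : HeckePair lam A B C f g) : HeckePair lam B A C g f :=
  ⟨h.sqB, h.sqA, h.sqC, fun t => (h.braid t).symm, h.antig, h.antif, h.compg, h.compf⟩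

theorem HeckePair.smul_bracket_braid (h : HeckePair lam A B C f g) (h1 : lam ≠ 1) (t : T) :
    lam • f (B t) = C (f t) - lam • f t + C (g t) := by
  -- Both sides below are `f (B (A (A (B t))))`.
  have key : C (C (f t)) = (lam - 1) • f (B (A (B t))) + lam • f (B (B t)) := by
    rw [h.compf, h.compg, h.sqA, map_add, map_smul, map_smul, map_add, map_smul, map_smul]
  rw [← h.braid, h.antif, ← h.compg, h.sqC, h.sqB, map_add, map_smul, map_smul] at key
  have h0 : (lam - 1) • (lam • f (B t) - (C (f t) - lam • f t + C (g t))) = 0 := by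
    linear_combination (norm := module) -key
  rw [smul_eq_zero_iff_right (sub_ne_zero.2 h1)] at h0
  exact sub_eq_zero.1 h0

theorem HeckePair.mixed_relation (h : HeckePair lam A B C f g) (h1 : lam ≠ 1) (t : T) :
    (1 + lam ^ 2) • C (g t) + C (f t) = (lam * (1 + lam)) • f t + lam • g t := by
  have e1 := h.smul_bracket_braid h1 (A t)
  rw [← h.compg, h.antif, map_neg] at e1
  have e2 := congrArg C (h.symm.smul_bracket_braid h1 t)
  simp only [map_add, map_sub, map_smul, h.sqC] at e2
  linear_combination (norm := module) lam • e1 + e2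

theorem HeckePair.add_eq_zero (h : HeckePair lam A B C f g) (h0 : lam ≠ 0) (h1 : lam ≠ 1)
    (h2 : (2 : K) ≠ 0) (h3 : 1 + lam + lam ^ 2 ≠ 0) (t : T) : f t + g t = 0 := by
  have hs : (2 + lam ^ 2) • C (f t + g t) = (lam * (2 + lam)) • (f t + g t) := by
    rw [map_add]
    linear_combination (norm := module) h.mixed_relation h1 t + h.symm.mixed_relation h1 t
  have hs' := congrArg C hs
  rw [map_smul, map_smul, h.sqC] at hs'
  -- With `q = 2 + λ²` and `r = λ (2 + λ)`, so that `q • C s = r • s`, the quadratic relation of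
  -- `C`, multiplied by `q²`, becomes `(r + q) (r - q λ) • s = 0`.
  have hz : (2 * (1 + lam + lam ^ 2) * (lam ^ 2 * (1 - lam))) • (f t + g t) = 0 := by
    linear_combination (norm := module)
      ((2 + lam ^ 2) * (lam - 1) - lam * (2 + lam)) • hs - (2 + lam ^ 2) • hs'
  have hne : 2 * (1 + lam + lam ^ 2) * (lam ^ 2 * (1 - lam)) ≠ 0 :=
    mul_ne_zero (mul_ne_zero h2 h3) (mul_ne_zero (pow_ne_zero 2 h0) (sub_ne_zero.2 h1.symm))
  exact (smul_eq_zero_iff_right hne).1 hz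

end HeckeModule

section Vanishing

variable {K : Type*} [Field K] {V : Type*} [AddCommGroup V] [Module K V]
  {c : V ⊗[K] V →ₗ[K] V ⊗[K] V} {lam : K} {b : V ⊗[K] V →ₗ[K] V}

theorem map₁_add_map₂_eq_zero (hc : IsBraiding c) (hH : IsHecke c lam) (hb : IsBracket c b)
    (hanti : b ∘ₗ c = -b) (h0 : lam ≠ 0) (h1 : lam ≠ 1) (h2 : (2 : K) ≠ 0)
    (h3 : 1 + lam + lam ^ 2 ≠ 0) (t : (V ⊗[K] V) ⊗[K] V) : map₁ b t + map₂ b t = 0 :=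
  HeckePair.add_eq_zero (A := op₁ c) (B := op₂ c) (C := c)
    ⟨hH.op₁_op₁, hH.op₂_op₂, hH.apply_apply, hc.apply, map₁_op₁_of_antisymm hanti,
      map₂_op₂_of_antisymm hanti, hb.apply_map₁, hb.apply_map₂⟩ h0 h1 h2 h3 t

theorem eq_zero_of_map₁_add_map₂ (h2 : (2 : K) ≠ 0) (h : ∀ t, map₁ b t + map₂ b t = 0) :
    b = 0 := by
  have hb (x y z : V) : b (x ⊗ₜ y) ⊗ₜ[K] z + x ⊗ₜ[K] b (y ⊗ₜ z) = 0 := by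
    simpa [map₁, map₂] using h ((x ⊗ₜ y) ⊗ₜ z)
  refine TensorProduct.ext' fun x y => ?_
  by_contra hv
  obtain ⟨φ, hφ⟩ := Module.Projective.exists_dual_ne_zero K (x := b (x ⊗ₜ y)) (by simpa using hv)
  -- Contracting the first factor with `φ` shows that `b (y ⊗ z)` is a multiple of `z`.
  have hz := congrArg ((TensorProduct.lid K V).toLinearMap ∘ₗ φ.rTensor V) (hb x y y)
  simp only [LinearMap.coe_comp, LinearEquiv.coe_coe, Function.comp_apply, map_add,
    LinearMap.rTensor_tmul, TensorProduct.lid_tmul, map_zero] at hz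
  -- Substituting this into `b (y ⊗ y) ⊗ y + y ⊗ b (y ⊗ y) = 0` gives `2 (y ⊗ y) = 0`.
  have hyy : (2 * φ (b (x ⊗ₜ y))) • (y ⊗ₜ[K] y) = 0 := by
    have e1 := congrArg (fun v => v ⊗ₜ[K] y) hz
    have e2 := congrArg (fun v => y ⊗ₜ[K] v) hz
    simp only [TensorProduct.add_tmul, TensorProduct.tmul_add, TensorProduct.tmul_smul,
      ← TensorProduct.smul_tmul', TensorProduct.zero_tmul, TensorProduct.tmul_zero] at e1 e2
    linear_combination (norm := module) e1 + e2 - φ x • hb y y y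
  rw [smul_eq_zero_iff_right (mul_ne_zero h2 hφ)] at hyy
  have hy : y = 0 := by
    by_contra hy
    obtain ⟨ψ, hψ⟩ := Module.Projective.exists_dual_ne_zero K hy
    have := congrArg ((TensorProduct.lid K K).toLinearMap ∘ₗ TensorProduct.map ψ ψ) hyy
    simp [hψ] at this
  exact hv (by simp [hy])

end Vanishing

/-! ### Relations in degrees two and three -/

section Relations

variable {K : Type*} [Field K] {V : Type*} [AddCommGroup V] [Module K V]
  {U : Type*} [Ring U] [Algebra K U]
  {c : V ⊗[K] V →ₗ[K] V ⊗[K] V} {lam : K} {b : V ⊗[K] V →ₗ[K] V}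

noncomputable section

/-- The map `V ⊗ V → U`, `v ⊗ w ↦ j v * j w`. -/
def mulTwo (j : V →ₗ[K] U) : V ⊗[K] V →ₗ[K] U :=
  LinearMap.mul' K U ∘ₗ TensorProduct.map j j

/-- The map `V ⊗ V ⊗ V → U`, `u ⊗ v ⊗ w ↦ j u * j v * j w`. -/
def mulThree (j : V →ₗ[K] U) : (V ⊗[K] V) ⊗[K] V →ₗ[K] U :=
  LinearMap.mul' K U ∘ₗ TensorProduct.map (mulTwo j) j

end

/-- The linear map `j` satisfies the defining relations of the enveloping algebra. -/
def SatisfiesRelations (c : V ⊗[K] V →ₗ[K] V ⊗[K] V) (lam : K) (b : V ⊗[K] V →ₗ[K] V)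
    (j : V →ₗ[K] U) : Prop :=
  ∀ z, mulTwo j (c z) - lam • mulTwo j z = j (b z)

variable {j : V →ₗ[K] U}

theorem SatisfiesRelations.mulThree_op₁ (hj : SatisfiesRelations c lam b j)
    (t : (V ⊗[K] V) ⊗[K] V) :
    mulThree j (op₁ c t) - lam • mulThree j t = mulTwo j (map₁ b t) := by
  induction t with
  | zero => simp
  | add s t hs ht =>
    simp only [map_add, smul_add]
    rw [← hs, ← ht]; abel
  | tmul z v =>
    simp [mulThree, op₁, map₁, mulTwo, ← hj z, sub_mul]

theorem mulThree_assoc_symm (j : V →ₗ[K] U) (v : V) (z : V ⊗[K] V) :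
    mulThree j ((TensorProduct.assoc K V V V).symm (v ⊗ₜ z)) = j v * mulTwo j z := by
  induction z with
  | zero => simp
  | add s t hs ht => simp [TensorProduct.tmul_add, hs, ht, mul_add]
  | tmul x y => simp [mulThree, mulTwo, mul_assoc]

theorem SatisfiesRelations.mulThree_op₂ (hj : SatisfiesRelations c lam b j)
    (t : (V ⊗[K] V) ⊗[K] V) :
    mulThree j (op₂ c t) - lam • mulThree j t = mulTwo j (map₂ b t) := by
  obtain ⟨s, rfl⟩ := (TensorProduct.assoc K V V V).symm.surjective t
  induction s with
  | zero => simp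
  | add s t hs ht =>
    simp only [map_add, smul_add]
    rw [← hs, ← ht]; abel
  | tmul v z =>
    have h1 : op₂ c ((TensorProduct.assoc K V V V).symm (v ⊗ₜ z)) =
        (TensorProduct.assoc K V V V).symm (v ⊗ₜ c z) := by simp [op₂, map₂]
    have h2 : map₂ b ((TensorProduct.assoc K V V V).symm (v ⊗ₜ z)) = v ⊗ₜ b z := by simp [map₂]
    rw [h1, h2, mulThree_assoc_symm, mulThree_assoc_symm]
    simp [mulTwo, ← hj z, mul_sub]

theorem bracket_comp_of_injective (hj : SatisfiesRelations c lam b j) (hinj : Function.Injective j)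
    (hH : IsHecke c lam) : b ∘ₗ c = -b := by
  refine LinearMap.ext fun z => ?_
  have h := hj (c z + z)
  rw [map_add c, hH.apply_apply] at h
  have h0 : j (b (c z + z)) = 0 := by
    rw [← h]
    simp only [map_add, map_smul]
    module
  have := (map_eq_zero_iff j hinj).1 h0
  rw [map_add] at this
  simpa using eq_neg_of_add_eq_zero_left this

theorem jacobi_of_injective (hj : SatisfiesRelations c (1 : K) b j) (hinj : Function.Injective j)
    (hc : IsBraiding c) (hH : IsHecke c (1 : K)) (hb : IsBracket c b) (h2 : (2 : K) ≠ 0) :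
    b ∘ₗ map₁ b ∘ₗ (LinearMap.id - op₂ c + op₂ c ∘ₗ op₁ c) = 0 := by
  have hanti := bracket_comp_of_injective hj hinj hH
  have hbc (z : V ⊗[K] V) : b (c z) = -b z := LinearMap.congr_fun hanti z
  have hcc (z : V ⊗[K] V) : c (c z) = z := by simpa using hH.apply_apply z
  refine LinearMap.ext fun t => ?_
  have hg (t : (V ⊗[K] V) ⊗[K] V) : map₂ b (op₁ c t) = c (map₁ b (op₂ c t)) := by
    have : op₂ c (op₂ c t) = t := by simpa using hH.op₂_op₂ t
    rw [hb.apply_map₁, this]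
  set w : V ⊗[K] V := map₁ b (op₂ c (op₁ c t) - op₂ c t + t)
    - map₂ b (op₁ c (op₂ c t) - op₁ c t + t) with hw
  -- The two arguments above are the quotients of the antisymmetrizer by `c₁ - 1` and `c₂ - 1`.
  have hmw : mulTwo j w = 0 := by
    rw [hw, map_sub, ← hj.mulThree_op₁, ← hj.mulThree_op₂]
    simp only [map_add, map_sub, hc.apply]
    module
  have hw' : w = c (map₂ b t) - map₁ b (op₂ c t) + map₁ b t
      - (c (map₁ b t) - c (map₁ b (op₂ c t)) + map₂ b t) := by
    simp only [hw, map_add, map_sub, ← hb.apply_map₁, ← hb.apply_map₂]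
    rw [hg]
  have hcw : c w = -w := by
    rw [hw']
    simp only [map_add, map_sub, hcc]
    abel
  have hbw : b w = 0 := by
    refine (map_eq_zero_iff j hinj).1 ?_
    rw [← hj w, hcw, map_neg, hmw]
    simp
  have hgt : b (map₂ b t) = -b (map₁ b (op₂ c (op₁ c t))) := by
    rw [← hb.apply_map₂, hbc, neg_neg]
  rw [hw'] at hbw
  simp only [map_add, map_sub, hbc, hgt] at hbw
  have h0 : (2 : K) • (b (map₁ b t) - b (map₁ b (op₂ c t)) + b (map₁ b (op₂ c (op₁ c t)))) = 0 := by
    linear_combination (norm := module) hbw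
  simpa using (smul_eq_zero_iff_right h2).1 h0

end Relations

theorem satisfiesRelations_envelopingι {K : Type*} [Field K] {V : Type*} [AddCommGroup V]
    [Module K V] (c : V ⊗[K] V →ₗ[K] V ⊗[K] V) (lam : K) (b : V ⊗[K] V →ₗ[K] V) :
    SatisfiesRelations c lam b (envelopingι c lam b) := by
  have hm (z : V ⊗[K] V) :
      mulTwo (envelopingι c lam b) z = envelopingProj c lam b (tensorSq z) := by
    induction z with
    | zero => simp
    | add s t hs ht => simp only [map_add, hs, ht]
    | tmul x y => simp [mulTwo, tensorSq, envelopingι]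
  intro z
  have hmem : tensorSq (c z) - lam • tensorSq z - TensorAlgebra.ι K (b z) ∈
      envelopingIdeal c lam b := TwoSidedIdeal.subset_span ⟨z, rfl⟩
  have h0 : envelopingProj c lam b
      (tensorSq (c z) - lam • tensorSq z - TensorAlgebra.ι K (b z)) = 0 :=
    (RingCon.eq _).2 ((TwoSidedIdeal.mem_iff _ _).1 hmem)
  rw [hm, hm]
  rw [map_sub, map_sub, map_smul] at h0
  exact sub_eq_zero.1 h0

end BraidedLie

theorem mainTheorem2 {K : Type*} [Field K] (hK : ringChar K ≠ 2)
    {V : Type*} [AddCommGroup V] [Module K V]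
    (c : V ⊗[K] V →ₗ[K] V ⊗[K] V) (hc : BraidedLie.IsBraiding c)
    (lam : K) (hlam : lam ≠ 0) (hHecke : BraidedLie.IsHecke c lam)
    (h3 : BraidedLie.qFactorial lam 3 ≠ 0)
    (b : V ⊗[K] V →ₗ[K] V) (hb : BraidedLie.IsBracket c b)
    (hinj : Function.Injective (BraidedLie.envelopingι c lam b)) :
    (lam ≠ 1 → b = 0) ∧
    (lam = 1 →
      b ∘ₗ c = -b ∧
      b ∘ₗ BraidedLie.map₁ b ∘ₗ
        (LinearMap.id - BraidedLie.op₂ c + BraidedLie.op₂ c ∘ₗ BraidedLie.op₁ c) = 0 ∧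
      BraidedLie.IsGeneralizedLieAlgebra c b) := by
  have h2 : (2 : K) ≠ 0 := Ring.two_ne_zero hK
  have hj := BraidedLie.satisfiesRelations_envelopingι c lam b
  have hanti := BraidedLie.bracket_comp_of_injective hj hinj hHecke
  refine ⟨fun h1 => ?_, ?_⟩
  · have h3' : 1 + lam + lam ^ 2 ≠ 0 := fun h => h3 <| by
      simp [BraidedLie.qFactorial, BraidedLie.qNumber, Finset.sum_range_succ, h]
    exact BraidedLie.eq_zero_of_map₁_add_map₂ h2
      (BraidedLie.map₁_add_map₂_eq_zero hc hHecke hb hanti hlam h1 h2 h3')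
  · rintro rfl
    have hjac := BraidedLie.jacobi_of_injective hj hinj hc hHecke hb h2
    have hinv : c ∘ₗ c = LinearMap.id :=
      LinearMap.ext fun z => by simpa using hHecke.apply_apply z
    exact ⟨hanti, hjac, hc, hinv, hb, hanti, hjac⟩
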